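/- Let $E$ be a finite set and $\mathcal{L}\subseteq 2^E$. For $e\in E$ the toggle $t_e:\mathcal{L}\to\mathcal{L}$ sends $X$ to $X\cup\{e\}$ if $e\notin X$ and $X\cup\{e\}\in\mathcal{L}$, to $X\setminus\{e\}$ if $e\in X$ and $X\setminus\{e\}\in\mathcal{L}$, and to $X$ otherwise. The toggle group $T(\mathcal{L})$ is the subgroup of the symmetric group $\mathfrak{S}_{\mathcal{L}}$ generated by all $t_e$, $e\in E$, and $\mathcal{L}$ is called toggle-alternating if $T(\mathcal{L})$ contains the alternating group $A_{\mathcal{L}}$. Let $G$ be a finite simple graph with vertex set $V(G)$, and let $\mathcal{IS}(G)\subseteq 2^{V(G)}$ be the set of independent sets of $G$, that is, of the sets of vertices no two of which are joined by an edge. 1. If $G$ is connected, then $\mathcal{IS}(G)$ is toggle-alternating. 2. If $G$ has connected components $G_1,\dots,G_k$, then $T(\mathcal{IS}(G))$ is the direct product of the toggle groups of the components: there is a group isomorphism $$\varphi: T(\mathcal{IS}(G))\to T(\mathcal{IS}(G_1))\times\cdots\times T(\mathcal{IS}(G_k)),\qquad g\mapsto(g_1,\dots,g_k),$$ such that $g_i(X\cap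 V(G_i))=g(X)\cap V(G_i)$ for all $g\in T(\mathcal{IS}(G))$, all $X\in\mathcal{IS}(G)$ and all $i$. -/

import Mathlib

namespace ToggleGroup

open scoped Classical in
/-- The toggle `t_e` of a family `L` of subsets of `E`, as a map `L → L`: add `e` if `e ∉ X` and the
result is in `L`, remove `e` if `e ∈ X` and the result is in `L`, and fix `X` otherwise. -/
noncomputable def toggleFun {E : Type*} (L : Set (Set E)) (e : E) (X : L) : L :=
  if h : e ∉ X.1 ∧ X.1 ∪ {e} ∈ L then ⟨X.1 ∪ {e}, h.2⟩
  else if h : e ∈ X.1 ∧ X.1 \ {e} ∈ L then ⟨X.1 \ {e}, h.2⟩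
  else X

theorem toggleFun_involutive {E : Type*} (L : Set (Set E)) (e : E) :
    Function.Involutive (toggleFun L e) := by
  rintro ⟨X, hX⟩
  by_cases he : e ∈ X
  · by_cases hL : X \ {e} ∈ L
    · have h1 : toggleFun L e ⟨X, hX⟩ = ⟨X \ {e}, hL⟩ := by simp [toggleFun, he, hL]
      have h2 : X \ {e} ∪ {e} = X := by
        rw [Set.sdiff_union_self, Set.union_eq_left]; simpa using he
      rw [h1]
      apply Subtype.ext
      rw [toggleFun, dif_pos ⟨by simp, by rw [h2]; exact hX⟩]
      exact h2
    · have h1 : toggleFun L e ⟨X, hX⟩ = ⟨X, hX⟩ := by simp [toggleFun, he, hL]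
      rw [h1, h1]
  · by_cases hL : X ∪ {e} ∈ L
    · have h1 : toggleFun L e ⟨X, hX⟩ = ⟨X ∪ {e}, hL⟩ := by
        rw [toggleFun, dif_pos ⟨he, hL⟩]
      have h2 : (X ∪ {e}) \ {e} = X := by
        rw [Set.union_sdiff_right]; exact Set.sdiff_singleton_eq_self he
      rw [h1]
      apply Subtype.ext
      rw [toggleFun, dif_neg (by simp), dif_pos ⟨by simp, by rw [h2]; exact hX⟩]
      exact h2
    · have h1 : toggleFun L e ⟨X, hX⟩ = ⟨X, hX⟩ := by
        rw [toggleFun, dif_neg (fun h => hL h.2), dif_neg (fun h => he h.1)]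
      rw [h1, h1]

/-- The toggle `t_e` as a permutation of `L`. -/
noncomputable def toggle {E : Type*} (L : Set (Set E)) (e : E) : Equiv.Perm L :=
  (toggleFun_involutive L e).toPerm

/-- The toggle group `T(L)`: the subgroup of the symmetric group on `L` generated by the toggles. -/
def toggleGroup {E : Type*} (L : Set (Set E)) : Subgroup (Equiv.Perm L) :=
  Subgroup.closure (Set.range (toggle L))

open scoped Classical in
/-- `L` is toggle-alternating if `T(L)` contains the alternating group on `L`. -/
def ToggleAlternating {E : Type*} [Finite E] (L : Set (Set E)) : Prop :=
  letI : Fintype L := Fintype.ofFinite L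
  alternatingGroup L ≤ toggleGroup L

/-- The family `IS(G)` of independent sets of vertices of `G`. -/
def indepSets {V : Type*} (G : SimpleGraph V) : Set (Set V) :=
  {X | G.IsIndepSet X}

/-- The part `X ∩ V(C)` of an independent set `X` of `G` in a connected component `C`, as an
independent set of the graph `C`. -/
def restrictToComponent {V : Type*} {G : SimpleGraph V} (C : G.ConnectedComponent)
    (X : indepSets G) : indepSets C.toSimpleGraph :=
  ⟨Subtype.val ⁻¹' X.1, fun _ hu _ hv huv hadj =>
    X.2 hu hv (fun h => huv (Subtype.ext h)) hadj⟩

end ToggleGroup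

/-!
Delete from a connected graph `G` a vertex `v` such that `G - v` is still connected. Each toggle of
`G - v` is the restriction of a toggle of `G`, so the alternating group on `IS(G - v)` is induced by
elements of `T(IS(G))`. If `w` is a neighbor of `v`, then `X ↦ X \ {v}` maps the independent sets
containing `v` injectively to independent sets of `G - v` other than `{w}`, so `IS(G - v)` makes up
more than half of `IS(G)`. Two things follow: the primitive action on `IS(G - v)` forces `T(IS(G))`
to be primitive, and, when `IS(G - v)` has at least five elements, simplicity of its alternating
group provides a 3-cycle in `T(IS(G))`, so that Jordan's theorem applies. Otherwise `G - v` is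
complete, `w` is adjacent to all other vertices of `G`, and the toggle at `w` is a transposition.

For the second part, `IS(G)` is the product of the sets `IS(C)` over the components `C`. The product
of the groups `T(IS(C))` acts faithfully on it, and its generators act as the toggles of `G`.
-/

namespace ToggleGroup

open Equiv Function MulAction
open Subgroup (closure)

section PermutationGroups

theorem map_ker_eq_top_of_card_lt {P A B : Type*} [Group P] [Group A] [IsSimpleGroup A] [Group B]
    [Finite B] {a : P →* A} (b : P →* B) (ha : Surjective a) (hAB : Nat.card B < Nat.card A) :
    b.ker.map a = ⊤ := by
  have hnormal : (b.ker.map a).Normal := .map inferInstance a ha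
  refine hnormal.eq_bot_or_eq_top.resolve_left fun hbot => hAB.not_ge ?_
  have hker : b.ker ≤ a.ker := (Subgroup.map_eq_bot_iff _).1 hbot
  calc
    Nat.card A = a.ker.index := by
      rw [Subgroup.index_ker, MonoidHom.range_eq_top.2 ha, Subgroup.card_top]
    _ ≤ b.ker.index := by
      refine Nat.le_of_dvd ?_ (Subgroup.index_dvd_of_le hker)
      rw [Subgroup.index_ker]
      exact Nat.card_pos
    _ = Nat.card b.range := Subgroup.index_ker b
    _ ≤ Nat.card B := Subgroup.card_le_card_group _

variable {α γ : Type*}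

theorem factorial_lt_card_alternatingGroup [Fintype α] [DecidableEq α] {m : ℕ}
    (h3 : 3 ≤ Nat.card α) (hm : m < Nat.card α) :
    m.factorial < Nat.card (alternatingGroup α) := by
  have : Nontrivial α := Finite.one_lt_card_iff_nontrivial.1 (by omega)
  have htwo : 2 * Nat.card (alternatingGroup α) = (Nat.card α).factorial :=
    two_mul_nat_card_alternatingGroup.trans Nat.card_perm
  obtain ⟨n, hn⟩ : ∃ n, Nat.card α = n + 1 := ⟨Nat.card α - 1, by omega⟩
  rw [hn, Nat.factorial_succ] at htwo
  have hmn : m.factorial ≤ n.factorial := Nat.factorial_le (by omega)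
  have hthree : 3 * n.factorial ≤ (n + 1) * n.factorial := Nat.mul_le_mul_right _ (by omega)
  have := n.factorial_pos
  omega

theorem isPreprimitive_of_alternatingGroup_le [Fintype α] [DecidableEq α] {H : Subgroup (Perm α)}
    [IsPretransitive H α] (hH : alternatingGroup α ≤ H) : IsPreprimitive H α := by
  rcases le_or_gt (Nat.card α) 2 with h2 | h3
  · exact ⟨fun {B} _ => isTrivialBlock_of_card_le_two h2 B⟩
  · have := alternatingGroup.isPreprimitive_of_three_le_card α h3
    let f : α →ₑ[Subgroup.inclusion hH] α := ⟨id, fun _ _ => rfl⟩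
    exact .of_surjective (f := f) surjective_id

/-- The pairs `(g, h)` of a permutation `g` of `α` and an element `h` of `H` which extends `g`
along `f : α → γ`. -/
def intertwiners (f : α → γ) (H : Subgroup (Perm γ)) : Subgroup (Perm α × Perm γ) where
  carrier := {p | p.2 ∈ H ∧ Semiconj f p.1 p.2}
  mul_mem' hp hq := ⟨mul_mem hp.1 hq.1, hp.2.comp_right hq.2⟩
  one_mem' := ⟨one_mem H, Semiconj.id_right⟩
  inv_mem' {p} hp :=
    ⟨inv_mem hp.1, hp.2.inverses_right p.1.apply_symm_apply p.2.symm_apply_apply⟩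

variable {f : α → γ} {H : Subgroup (Perm γ)}

theorem exists_semiconj_of_mem_closure {S : Set (Perm α)}
    (hS : ∀ g ∈ S, ∃ h ∈ H, Semiconj f g h) {g : Perm α} (hg : g ∈ closure S) :
    ∃ h ∈ H, Semiconj f g h := by
  have hle : closure S ≤ (intertwiners f H).map (MonoidHom.fst _ _) := by
    refine (Subgroup.closure_le _).2 fun g hg => ?_
    obtain ⟨h, hH, hgh⟩ := hS g hg
    exact ⟨(g, h), ⟨hH, hgh⟩, rfl⟩
  obtain ⟨⟨_, h⟩, ⟨hH, hgh⟩, rfl⟩ := hle hg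
  exact ⟨h, hH, hgh⟩

theorem apply_mem_range_iff_of_semiconj {g : Perm α} {h : Perm γ} (hgh : Semiconj f g h) (y : γ) :
    h y ∈ Set.range f ↔ y ∈ Set.range f := by
  constructor
  · rintro ⟨x, hx⟩
    refine ⟨g.symm x, h.injective ?_⟩
    rw [← hgh, g.apply_symm_apply, hx]
  · rintro ⟨x, rfl⟩
    exact ⟨g x, hgh x⟩

/-- The action of the pairs `(g, h)` of `intertwiners f H` on the complement of the range of `f`,
through the second component. -/
def intertwinersComplHom (f : α → γ) (H : Subgroup (Perm γ)) :
    intertwiners f H →* Perm ↥(Set.range f)ᶜ where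
  toFun p := p.1.2.subtypePerm fun y => (apply_mem_range_iff_of_semiconj p.2.2 y).not
  map_one' := rfl
  map_mul' _ _ := rfl

theorem cycleType_eq_of_semiconj [Fintype α] [DecidableEq α] [Fintype γ] [DecidableEq γ]
    (hf : Injective f) {g : Perm α} {h : Perm γ} (hgh : Semiconj f g h)
    (hfix : ∀ y ∉ Set.range f, h y = y) : h.cycleType = g.cycleType := by
  classical
  have : h = g.extendDomain (Equiv.ofInjective f hf) := by
    ext y
    by_cases hy : y ∈ Set.range f
    · obtain ⟨x, rfl⟩ := hy
      exact (hgh x).symm.trans (Perm.extendDomain_apply_image g (Equiv.ofInjective f hf) x).symm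
    · rw [hfix y hy, Perm.extendDomain_apply_not_subtype _ _ hy]
  rw [this, Perm.cycleType_extendDomain]

theorem isPreprimitive_of_forall_semiconj [Finite γ] {K : Subgroup (Perm α)} [IsPreprimitive K α]
    [IsPretransitive H γ] (hf : Injective f) (hcard : Nat.card γ < 2 * Nat.card α)
    (hext : ∀ g ∈ K, ∃ h ∈ H, Semiconj f g h) : IsPreprimitive H γ := by
  choose φ hφ hsemi using hext
  let F : α →ₑ[fun g : K => (⟨φ g g.2, hφ g g.2⟩ : H)] γ := ⟨f, fun g => hsemi g g.2⟩
  refine .of_card_lt (f := F) ?_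
  rwa [show Set.range F = Set.range f from rfl, Set.ncard_range_of_injective hf]

/- As `γ` has fewer points outside the range of `f` than `α` has points, the simple group
`alternatingGroup α` is too large to be recovered from the action of the extensions on those points.
Hence every even permutation has an extension that fixes all of them. -/
theorem exists_isThreeCycle_mem_of_forall_semiconj [Fintype α] [DecidableEq α] [Fintype γ]
    [DecidableEq γ] (hf : Injective f) (h5 : 5 ≤ Nat.card α) (hcard : Nat.card γ < 2 * Nat.card α)
    (hext : ∀ g ∈ alternatingGroup α, ∃ h ∈ H, Semiconj f g h) :
    ∃ h ∈ H, h.IsThreeCycle := by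
  have := alternatingGroup.isSimpleGroup h5
  let P := (alternatingGroup α).comap ((MonoidHom.fst _ _).comp (intertwiners f H).subtype)
  let a : P →* alternatingGroup α := MonoidHom.subgroupComap _ _
  have ha : Surjective a := fun ⟨g, hg⟩ => by
    obtain ⟨h, hH, hgh⟩ := hext g hg
    exact ⟨⟨⟨(g, h), hH, hgh⟩, hg⟩, rfl⟩
  let b : P →* Perm ↥(Set.range f)ᶜ := (intertwinersComplHom f H).comp P.subtype
  have hcompl : Nat.card ↥(Set.range f)ᶜ < Nat.card α := by
    have := Set.ncard_add_ncard_compl (Set.range f)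
    rw [Set.ncard_range_of_injective hf] at this
    rw [Nat.card_coe_set_eq]
    omega
  have htop : b.ker.map a = ⊤ := map_ker_eq_top_of_card_lt b ha <| by
    rw [Nat.card_perm]
    exact factorial_lt_card_alternatingGroup (by omega) hcompl
  obtain ⟨g, hg⟩ : ∃ g : Perm α, g.IsThreeCycle := by
    obtain ⟨x, y, z, hxy, hxz, hyz⟩ :=
      (Fintype.two_lt_card_iff (α := α)).1 (by rw [← Nat.card_eq_fintype_card]; omega)
    exact ⟨_, Perm.isThreeCycle_swap_mul_swap_same hxy hxz hyz⟩
  obtain ⟨⟨⟨⟨g', h⟩, hH, hgh⟩, _⟩, hb, hag⟩ :=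
    htop.ge (Subgroup.mem_top ⟨g, hg.mem_alternatingGroup⟩)
  obtain rfl : g' = g := congrArg Subtype.val hag
  refine ⟨h, hH, (cycleType_eq_of_semiconj hf hgh fun y hy => ?_).trans hg⟩
  exact congrArg Subtype.val (Perm.congr_fun hb ⟨y, hy⟩)

theorem alternatingGroup_le_of_forall_semiconj [Fintype α] [DecidableEq α] [Fintype γ]
    [DecidableEq γ] [IsPretransitive H γ] (hf : Injective f) (h5 : 5 ≤ Nat.card α)
    (hcard : Nat.card γ < 2 * Nat.card α)
    (hext : ∀ g ∈ alternatingGroup α, ∃ h ∈ H, Semiconj f g h) : alternatingGroup γ ≤ H := by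
  have := alternatingGroup.isPreprimitive_of_three_le_card α (by omega)
  have hprim : IsPreprimitive H γ := isPreprimitive_of_forall_semiconj hf hcard hext
  obtain ⟨h, hH, h3⟩ := exists_isThreeCycle_mem_of_forall_semiconj hf h5 hcard hext
  exact Perm.alternatingGroup_le_of_isPreprimitive_of_isThreeCycle_mem hprim h3 hH

end PermutationGroups

section Families

variable {E : Type*} {L : Set (Set E)}

theorem toggle_mem_toggleGroup (L : Set (Set E)) (e : E) : toggle L e ∈ toggleGroup L :=
  Subgroup.subset_closure ⟨e, rfl⟩

theorem mem_toggle_of_ne {e x : E} (hx : x ≠ e) (X : L) : x ∈ (toggle L e X).1 ↔ x ∈ X.1 := by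
  change x ∈ (toggleFun L e X).1 ↔ _
  unfold toggleFun
  split_ifs <;> simp [hx]

theorem self_mem_toggle (e : E) (X : L) :
    e ∈ (toggle L e X).1 ↔ (e ∈ X.1 ∧ X.1 \ {e} ∉ L) ∨ (e ∉ X.1 ∧ X.1 ∪ {e} ∈ L) := by
  change e ∈ (toggleFun L e X).1 ↔ _
  unfold toggleFun
  split_ifs <;> grind

theorem self_mem_toggle_of_isLowerSet (hL : IsLowerSet L) (e : E) (X : L) :
    e ∈ (toggle L e X).1 ↔ e ∉ X.1 ∧ X.1 ∪ {e} ∈ L := by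
  rw [self_mem_toggle]
  exact or_iff_right fun h => h.2 (hL Set.sdiff_subset X.2)

theorem coe_toggle_of_union_mem {e : E} {X : L} (he : e ∉ X.1) (h : X.1 ∪ {e} ∈ L) :
    (toggle L e X).1 = X.1 ∪ {e} :=
  congrArg Subtype.val (dif_pos ⟨he, h⟩)

theorem toggle_eq_self {e : E} {X : L} (he : e ∉ X.1) (h : X.1 ∪ {e} ∉ L) : toggle L e X = X :=
  (dif_neg fun h' => h h'.2).trans (dif_neg fun h' => he h'.1)

theorem toggle_eq_swap [DecidableEq L] {e : E} (hempty : ∅ ∈ L) (hsingle : {e} ∈ L)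
    (huniq : ∀ X ∈ L, e ∈ X → X = {e}) : toggle L e = swap ⟨∅, hempty⟩ ⟨{e}, hsingle⟩ := by
  have h : toggle L e ⟨∅, hempty⟩ = ⟨{e}, hsingle⟩ := Subtype.ext <| by
    simpa using coe_toggle_of_union_mem (X := ⟨∅, hempty⟩) (Set.notMem_empty e) (by simpa)
  ext1 X
  rw [swap_apply_def]
  split_ifs with hX hX'
  · rw [hX, h]
  · rw [hX', ← h]
    exact toggleFun_involutive L e _
  · have he : e ∉ X.1 := fun he => hX' (Subtype.ext (huniq _ X.2 he))
    refine toggle_eq_self he fun hmem => hX (Subtype.ext ?_)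
    have hsub := huniq _ hmem (Or.inr rfl)
    refine Set.eq_empty_of_forall_notMem fun x hx => he ?_
    rwa [← show x = e from hsub.le (Or.inl hx)]

theorem exists_toggleGroup_smul_empty_eq (hL : IsLowerSet L) (X : L) (hfin : X.1.Finite) :
    ∃ g : toggleGroup L, g • (⟨∅, hL (Set.empty_subset X.1) X.2⟩ : L) = X := by
  obtain ⟨X, hX⟩ := X
  dsimp only at hfin ⊢
  induction X, hfin using Set.Finite.induction_on with
  | empty => exact ⟨1, one_smul _ _⟩
  | @insert e X he _ ih =>
    obtain ⟨g, hg⟩ := ih (hL (Set.subset_insert e X) hX)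
    refine ⟨⟨_, toggle_mem_toggleGroup L e⟩ * g, Subtype.ext ?_⟩
    rw [mul_smul, hg]
    rw [← Set.union_singleton] at hX
    exact (coe_toggle_of_union_mem (X := ⟨X, _⟩) he hX).trans Set.union_singleton

theorem isPretransitive_toggleGroup (hL : IsLowerSet L) (hfin : ∀ X ∈ L, X.Finite) :
    IsPretransitive (toggleGroup L) L where
  exists_smul_eq X Y := by
    obtain ⟨g, hg⟩ := exists_toggleGroup_smul_empty_eq hL X (hfin _ X.2)
    obtain ⟨h, hh⟩ := exists_toggleGroup_smul_empty_eq hL Y (hfin _ Y.2)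
    exact ⟨h * g⁻¹, by rw [mul_smul, inv_smul_eq_iff.2 hg.symm, hh]⟩

/-- The members of `L` contained in `s`, as a family of subsets of the type `s`. -/
def induced (L : Set (Set E)) (s : Set E) : Set (Set s) :=
  {Y | (↑) '' Y ∈ L}

variable {s : Set E}

theorem union_singleton_mem_induced (e : s) (Y : Set s) :
    Y ∪ {e} ∈ induced L s ↔ (↑) '' Y ∪ {e.1} ∈ L := by
  rw [induced, Set.mem_ofPred_eq, Set.image_union, Set.image_singleton]

theorem sdiff_singleton_mem_induced (e : s) (Y : Set s) :
    Y \ {e} ∈ induced L s ↔ (↑) '' Y \ {e.1} ∈ L := by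
  rw [induced, Set.mem_ofPred_eq, Set.image_sdiff Subtype.val_injective, Set.image_singleton]

/-- A member of the induced family, regarded as a member of the original family. -/
def ofInduced (Y : induced L s) : L :=
  ⟨Subtype.val '' Y.1, Y.2⟩

theorem ofInduced_injective : Injective (ofInduced : induced L s → L) := fun _ _ h =>
  Subtype.ext (Subtype.val_injective.image_injective (congrArg Subtype.val h))

theorem coe_mem_ofInduced {x : s} {Y : induced L s} : x.1 ∈ (ofInduced Y).1 ↔ x ∈ Y.1 :=
  Subtype.val_injective.mem_set_image

theorem coe_ofInduced_subset (Y : induced L s) : (ofInduced Y).1 ⊆ s :=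
  Subtype.coe_image_subset s Y.1

theorem ofInduced_toggle (e : s) :
    Semiconj (ofInduced : induced L s → L) (toggle (induced L s) e) (toggle L e) := by
  intro Y
  ext x
  by_cases hx : x ∈ s
  · lift x to s using hx
    rw [coe_mem_ofInduced]
    by_cases hxe : x = e
    · subst hxe
      rw [self_mem_toggle, self_mem_toggle, coe_mem_ofInduced, sdiff_singleton_mem_induced,
        union_singleton_mem_induced]
      rfl
    · rw [mem_toggle_of_ne hxe, mem_toggle_of_ne (Subtype.coe_ne_coe.2 hxe), coe_mem_ofInduced]
  · have hxe : x ≠ e := fun h => hx (h ▸ e.2)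
    rw [mem_toggle_of_ne hxe]
    exact iff_of_false (fun h => hx (coe_ofInduced_subset _ h))
      fun h => hx (coe_ofInduced_subset _ h)

theorem ncard_induced (L : Set (Set E)) (s : Set E) :
    (induced L s).ncard = {X ∈ L | X ⊆ s}.ncard := by
  rw [← Set.ncard_image_of_injective _ Subtype.val_injective.image_injective]
  congr 1
  ext X
  constructor
  · rintro ⟨Y, hY, rfl⟩
    exact ⟨hY, Subtype.coe_image_subset s Y⟩
  · rintro ⟨hX, hXs⟩
    have himage : (↑) '' ((↑) ⁻¹' X : Set s) = X := by simpa using hXs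
    exact ⟨(↑) ⁻¹' X, by rwa [induced, Set.mem_ofPred_eq, himage], himage⟩

/- Removing `e` embeds the members of `L` that contain `e` into those that do not, and it misses
`Y`. -/
theorem card_lt_two_mul_card_induced_compl_singleton [Finite L] (hL : IsLowerSet L) {e : E}
    {Y : Set E} (hY : Y ∈ L) (heY : e ∉ Y) (hins : insert e Y ∉ L) :
    Nat.card L < 2 * Nat.card (induced L {e}ᶜ) := by
  have hunion : {X ∈ L | e ∈ X} ∪ {X ∈ L | e ∉ X} = L := by
    rw [← Set.sep_or]
    simp [em]
  have hinj : Set.InjOn (· \ {e}) {X ∈ L | e ∈ X} := fun X hX X' hX' h => by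
    rw [← Set.insert_sdiff_self_of_mem hX.2, ← Set.insert_sdiff_self_of_mem hX'.2]
    exact congrArg (insert e) h
  have hlt : {X ∈ L | e ∈ X}.ncard < {X ∈ L | e ∉ X}.ncard := by
    rw [← hinj.ncard_image]
    refine Set.ncard_lt_ncard ((Set.ssubset_iff_of_subset ?_).2 ⟨Y, ⟨hY, heY⟩, ?_⟩)
      (L.toFinite.subset (Set.sep_subset _ _))
    · rintro _ ⟨X, hX, rfl⟩
      exact ⟨hL Set.sdiff_subset hX.1, by simp⟩
    · rintro ⟨X, hX, rfl⟩
      exact hins ((Set.insert_sdiff_self_of_mem hX.2).symm ▸ hX.1)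
  have hle := Set.ncard_union_le {X ∈ L | e ∈ X} {X ∈ L | e ∉ X}
  rw [hunion] at hle
  rw [Nat.card_coe_set_eq, Nat.card_coe_set_eq, ncard_induced]
  simp only [Set.subset_compl_singleton_iff]
  omega

theorem exists_mem_toggleGroup_semiconj {g : Perm (induced L s)}
    (hg : g ∈ toggleGroup (induced L s)) :
    ∃ h ∈ toggleGroup L, Semiconj ofInduced g h := by
  refine exists_semiconj_of_mem_closure ?_ hg
  rintro _ ⟨e, rfl⟩
  exact ⟨_, toggle_mem_toggleGroup L e, ofInduced_toggle e⟩

variable [Finite E]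

theorem toggleAlternating_iff [Fintype L] [DecidableEq L] :
    ToggleAlternating L ↔ alternatingGroup L ≤ toggleGroup L := by
  unfold ToggleAlternating
  convert Iff.rfl

theorem isPreprimitive_toggleGroup_of_induced (hL : IsLowerSet L)
    (hcard : Nat.card L < 2 * Nat.card (induced L s)) (hs : ToggleAlternating (induced L s)) :
    IsPreprimitive (toggleGroup L) L := by
  classical
  have hLs : IsLowerSet (induced L s) := fun _ _ h => hL (Set.image_mono h)
  have := isPretransitive_toggleGroup hL fun X _ => X.toFinite
  have := isPretransitive_toggleGroup hLs fun X _ => X.toFinite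
  have : Fintype (induced L s) := .ofFinite _
  have : IsPreprimitive (toggleGroup (induced L s)) (induced L s) :=
    isPreprimitive_of_alternatingGroup_le (toggleAlternating_iff.1 hs)
  exact isPreprimitive_of_forall_semiconj ofInduced_injective hcard fun _ =>
    exists_mem_toggleGroup_semiconj

theorem toggleAlternating_of_induced (hL : IsLowerSet L) (h5 : 5 ≤ Nat.card (induced L s))
    (hcard : Nat.card L < 2 * Nat.card (induced L s)) (hs : ToggleAlternating (induced L s)) :
    ToggleAlternating L := by
  classical
  have := isPretransitive_toggleGroup hL fun X _ => X.toFinite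
  have : Fintype (induced L s) := .ofFinite _
  have : Fintype L := .ofFinite _
  rw [toggleAlternating_iff] at hs ⊢
  exact alternatingGroup_le_of_forall_semiconj ofInduced_injective h5 hcard fun _ hg =>
    exists_mem_toggleGroup_semiconj (hs hg)

end Families

section Graphs

variable {V : Type*} {G : SimpleGraph V}

theorem isLowerSet_indepSets : IsLowerSet (indepSets G) :=
  fun _ _ hYX hX => Set.Pairwise.mono hYX hX

theorem indepSets_induce (G : SimpleGraph V) (s : Set V) :
    indepSets (G.induce s) = induced (indepSets G) s := by
  ext Y
  exact (Subtype.val_injective.injOn.pairwise_image (r := fun v w => ¬G.Adj v w)).symm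

theorem union_singleton_mem_indepSets {X : Set V} (hX : X ∈ indepSets G) {v : V} (hv : v ∉ X) :
    X ∪ {v} ∈ indepSets G ↔ ∀ u ∈ X, ¬G.Adj v u := by
  have : Std.Symm fun a b => ¬G.Adj a b := ⟨fun _ _ => mt .symm⟩
  rw [Set.union_singleton]
  exact (Set.pairwise_insert_of_symm_of_notMem hv).trans (and_iff_right hX)

theorem pair_mem_indepSets {u v : V} (h : ¬G.Adj u v) : {u, v} ∈ indepSets G := by
  rintro _ (rfl | rfl) _ (rfl | rfl) hne
  exacts [(hne rfl).elim, h, mt .symm h, (hne rfl).elim]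

theorem singleton_mem_indepSets (v : V) : {v} ∈ indepSets G :=
  Set.pairwise_singleton v _

theorem empty_mem_indepSets : ∅ ∈ indepSets G :=
  Set.pairwise_empty _

theorem card_add_two_le_card_indepSets [Finite V] (hG : G ≠ ⊤) :
    Nat.card V + 2 ≤ Nat.card (indepSets G) := by
  obtain ⟨u, v, huv, hadj⟩ := SimpleGraph.ne_top_iff_exists_not_adj.1 hG
  have hempty : ∅ ∉ Set.range (singleton : V → Set V) := fun ⟨x, hx⟩ =>
    Set.singleton_ne_empty x hx
  have hpair : {u, v} ∉ insert ∅ (Set.range (singleton : V → Set V)) := by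
    rintro (h | ⟨x, hx⟩)
    · exact (Set.insert_nonempty u {v}).ne_empty h
    · have hu : u = x := hx.ge (Or.inl rfl)
      have hv : v = x := hx.ge (Or.inr rfl)
      exact huv (hu.trans hv.symm)
  calc
    Nat.card V + 2 = (insert {u, v} (insert ∅ (Set.range (singleton : V → Set V)))).ncard := by
      rw [Set.ncard_insert_of_notMem hpair, Set.ncard_insert_of_notMem hempty,
        Set.ncard_range_of_injective Set.singleton_injective]
    _ ≤ (indepSets G).ncard := by
      refine Set.ncard_le_ncard ?_
      rintro _ (rfl | rfl | ⟨x, rfl⟩)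
      exacts [pair_mem_indepSets hadj, empty_mem_indepSets, singleton_mem_indepSets x]
    _ = Nat.card (indepSets G) := (Nat.card_coe_set_eq _).symm

theorem three_le_card_of_connected_of_ne_top [Finite V] (hG : G.Connected) (htop : G ≠ ⊤) :
    3 ≤ Nat.card V := by
  obtain ⟨u, v, huv, hadj⟩ := SimpleGraph.ne_top_iff_exists_not_adj.1 htop
  have : Nontrivial V := ⟨u, v, huv⟩
  obtain ⟨w, huw⟩ := hG.preconnected.exists_adj_of_nontrivial u
  have := Fintype.ofFinite V
  rw [Nat.card_eq_fintype_card]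
  exact Fintype.two_lt_card_iff.2 ⟨u, v, w, huv, huw.ne, by rintro rfl; exact hadj huw⟩

theorem five_le_card_indepSets [Finite V] (hG : G.Connected) (htop : G ≠ ⊤) :
    5 ≤ Nat.card (indepSets G) := by
  have := three_le_card_of_connected_of_ne_top hG htop
  have := card_add_two_le_card_indepSets htop
  omega

theorem adj_of_induce_compl_singleton_eq_top {v w : V} (hvw : G.Adj v w)
    (htop : G.induce {v}ᶜ = ⊤) {u : V} (huw : u ≠ w) : G.Adj w u := by
  by_cases huv : u = v
  · exact huv ▸ hvw.symm
  · have hadj : (G.induce {v}ᶜ).Adj ⟨w, hvw.ne'⟩ ⟨u, huv⟩ := by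
      rw [htop]
      exact fun h => huw (congrArg Subtype.val h).symm
    exact hadj

theorem isSwap_toggle_of_forall_adj [DecidableEq (indepSets G)] {w : V}
    (hw : ∀ u ≠ w, G.Adj w u) : (toggle (indepSets G) w).IsSwap := by
  refine ⟨_, _, ?_, toggle_eq_swap empty_mem_indepSets (singleton_mem_indepSets w) ?_⟩
  · exact fun h => Set.singleton_ne_empty w (congrArg Subtype.val h).symm
  · refine fun X hX hwX => Set.eq_singleton_iff_unique_mem.2 ⟨hwX, fun u hu => ?_⟩
    by_contra huw
    exact hX hwX hu (Ne.symm huw) (hw u huw)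

theorem card_indepSets_lt_two_mul_card_induced [Finite V] {v w : V} (hvw : G.Adj v w) :
    Nat.card (indepSets G) < 2 * Nat.card (induced (indepSets G) {v}ᶜ) := by
  refine card_lt_two_mul_card_induced_compl_singleton isLowerSet_indepSets
    (singleton_mem_indepSets w) hvw.ne fun hmem => ?_
  exact hmem (Or.inl rfl) (Or.inr rfl) hvw.ne hvw

theorem toggleAlternating_of_subsingleton {E : Type*} [Finite E] [Subsingleton E]
    (L : Set (Set E)) : ToggleAlternating L := by
  classical
  have : Fintype E := .ofFinite E
  have : Fintype L := .ofFinite L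
  have hcard : Nat.card L ≤ 2 := calc
    Nat.card L ≤ Nat.card (Set E) := Finite.card_subtype_le _
    _ = 2 ^ Fintype.card E := by rw [Nat.card_eq_fintype_card, Fintype.card_set]
    _ ≤ 2 ^ 1 := Nat.pow_le_pow_right two_pos (Fintype.card_le_one_iff_subsingleton.2 ‹_›)
  rw [toggleAlternating_iff, alternatingGroup.eq_bot_of_card_le_two hcard]
  exact bot_le

theorem toggleAlternating_indepSets_of_forall_adj [Finite V] {w : V} (hw : ∀ u ≠ w, G.Adj w u)
    (hprim : IsPreprimitive (toggleGroup (indepSets G)) (indepSets G)) :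
    ToggleAlternating (indepSets G) := by
  classical
  have : Fintype (indepSets G) := .ofFinite _
  have htop : toggleGroup (indepSets G) = ⊤ :=
    Perm.subgroup_eq_top_of_isPreprimitive_of_isSwap_mem hprim _
      (isSwap_toggle_of_forall_adj hw) (toggle_mem_toggleGroup _ w)
  rw [toggleAlternating_iff, htop]
  exact le_top

theorem toggleAlternating_indepSets [Finite V] (hG : G.Connected) :
    ToggleAlternating (indepSets G) := by
  induction hn : Nat.card V using Nat.strong_induction_on generalizing V with
  | _ n ih =>
  rcases subsingleton_or_nontrivial V with _ | _
  · exact toggleAlternating_of_subsingleton _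
  obtain ⟨v, hv⟩ := hG.exists_connected_induce_compl_singleton_of_finite_nontrivial
  obtain ⟨w, hvw⟩ := hG.preconnected.exists_adj_of_nontrivial v
  have hlt : Nat.card ↥({v}ᶜ : Set V) < n := hn ▸ Finite.card_subtype_lt (x := v) (by simp)
  have halt : ToggleAlternating (induced (indepSets G) {v}ᶜ) :=
    indepSets_induce G {v}ᶜ ▸ ih _ hlt hv rfl
  have hcard := card_indepSets_lt_two_mul_card_induced hvw
  by_cases htop : G.induce {v}ᶜ = ⊤
  · exact toggleAlternating_indepSets_of_forall_adj
      (fun _ => adj_of_induce_compl_singleton_eq_top hvw htop)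
      (isPreprimitive_toggleGroup_of_induced isLowerSet_indepSets hcard halt)
  · refine toggleAlternating_of_induced isLowerSet_indepSets ?_ hcard halt
    exact indepSets_induce G {v}ᶜ ▸ five_le_card_indepSets hv htop

end Graphs

section Products

variable {ι : Type*} {M : ι → Type*} [∀ i, Group (M i)]

theorem closure_iUnion_image_mulSingle [Finite ι] [DecidableEq ι] {S : ∀ i, Set (M i)}
    (hS : ∀ i, closure (S i) = ⊤) : closure (⋃ i, Pi.mulSingle i '' S i) = ⊤ := by
  rw [← top_le_iff, ← Subgroup.pi_top Set.univ, Subgroup.pi_le_iff]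
  intro i
  rw [← hS i, MonoidHom.map_closure]
  exact Subgroup.closure_mono (Set.subset_iUnion_of_subset i subset_rfl)

theorem faithfulSMul_pi {β : ι → Type*} [∀ i, Nonempty (β i)] [∀ i, MulAction (M i) (β i)]
    [∀ i, FaithfulSMul (M i) (β i)] : FaithfulSMul (∀ i, M i) (∀ i, β i) where
  eq_of_smul_eq_smul {g h} hgh := by
    classical
    funext i
    refine eq_of_smul_eq_smul (α := β i) fun y => ?_
    simpa using congrFun (hgh (update (fun i => Classical.arbitrary (β i)) i y)) i

end Products

section Components

variable {V : Type*} {G : SimpleGraph V}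

theorem restrictToComponent_toggle (C : G.ConnectedComponent) (v : C) (X : indepSets G) :
    restrictToComponent C (toggle (indepSets G) v X) =
      toggle (indepSets C.toSimpleGraph) v (restrictToComponent C X) := by
  have hadj : (∀ u ∈ X.1, ¬G.Adj v u) ↔
      ∀ u ∈ (restrictToComponent C X).1, ¬C.toSimpleGraph.Adj v u :=
    ⟨fun h u => h u, fun h u hu hvu => h ⟨u, C.mem_supp_of_adj_mem_supp v.2 hvu⟩ hu hvu⟩
  have hunion : v.1 ∉ X.1 ∧ X.1 ∪ {v.1} ∈ indepSets G ↔ v ∉ (restrictToComponent C X).1 ∧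
      (restrictToComponent C X).1 ∪ {v} ∈ indepSets C.toSimpleGraph := by
    refine and_congr_right fun hv => ?_
    rw [union_singleton_mem_indepSets X.2 hv, hadj,
      union_singleton_mem_indepSets (restrictToComponent C X).2 hv]
  ext w
  change w.1 ∈ (toggle (indepSets G) v X).1 ↔ _
  by_cases hwv : w = v
  · rw [hwv, self_mem_toggle_of_isLowerSet isLowerSet_indepSets, hunion,
      self_mem_toggle_of_isLowerSet isLowerSet_indepSets]
  · rw [mem_toggle_of_ne hwv, mem_toggle_of_ne (Subtype.coe_ne_coe.2 hwv)]
    rfl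

theorem restrictToComponent_toggle_of_notMem {C : G.ConnectedComponent} {v : V} (hv : v ∉ C.supp)
    (X : indepSets G) :
    restrictToComponent C (toggle (indepSets G) v X) = restrictToComponent C X := by
  ext w
  exact mem_toggle_of_ne (x := w.1) (by rintro rfl; exact hv w.2) X

theorem restrictToComponent_ext {X Y : indepSets G}
    (h : ∀ C, restrictToComponent C X = restrictToComponent C Y) : X = Y := by
  ext v
  exact Set.ext_iff.1 (congrArg Subtype.val (h (G.connectedComponentMk v))) ⟨v, rfl⟩

theorem restrictToComponent_bijective :
    Bijective fun (X : indepSets G) (C : G.ConnectedComponent) => restrictToComponent C X := by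
  refine ⟨fun X X' h => restrictToComponent_ext (congrFun h), fun Y => ?_⟩
  let X : Set V := {v | ∀ (C : G.ConnectedComponent) (hv : v ∈ C.supp), ⟨v, hv⟩ ∈ (Y C).1}
  have hX : X ∈ indepSets G := fun u hu v hv huv hadj => by
    have hvu : v ∈ (G.connectedComponentMk u).supp :=
      SimpleGraph.ConnectedComponent.mem_supp_of_adj_mem_supp _ rfl hadj
    exact (Y _).2 (hu _ rfl) (hv _ hvu) (fun h => huv (congrArg Subtype.val h)) hadj
  refine ⟨⟨X, hX⟩, ?_⟩
  ext C ⟨v, hv⟩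
  refine ⟨fun h => h C hv, ?_⟩
  rintro hvY _ rfl
  obtain rfl : G.connectedComponentMk v = C := hv
  exact hvY

/-- An independent set is the same as a choice of an independent set in every component. -/
noncomputable def indepSetsEquivPi (G : SimpleGraph V) :
    indepSets G ≃ ((C : G.ConnectedComponent) → indepSets C.toSimpleGraph) :=
  .ofBijective _ restrictToComponent_bijective

/-- The action of the product of the toggle groups of the components on the independent sets of
the whole graph. -/
noncomputable def piToggleHom (G : SimpleGraph V) :
    ((C : G.ConnectedComponent) → toggleGroup (indepSets C.toSimpleGraph)) →* Perm (indepSets G) :=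
  (indepSetsEquivPi G).symm.permCongrHom.toMonoidHom.comp (toPermHom _ _)

theorem restrictToComponent_piToggleHom
    (h : (C : G.ConnectedComponent) → toggleGroup (indepSets C.toSimpleGraph))
    (C : G.ConnectedComponent) (X : indepSets G) :
    restrictToComponent C (piToggleHom G h X) = (h C).1 (restrictToComponent C X) :=
  congrFun ((indepSetsEquivPi G).apply_symm_apply (h • indepSetsEquivPi G X)) C

theorem piToggleHom_injective : Injective (piToggleHom G) := by
  have (C : G.ConnectedComponent) : Nonempty (indepSets C.toSimpleGraph) :=
    ⟨⟨∅, empty_mem_indepSets⟩⟩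
  have : FaithfulSMul ((C : G.ConnectedComponent) → toggleGroup (indepSets C.toSimpleGraph))
      ((C : G.ConnectedComponent) → indepSets C.toSimpleGraph) := faithfulSMul_pi
  exact (indepSetsEquivPi G).symm.permCongrHom.injective.comp toPerm_injective

theorem piToggleHom_mulSingle_toggle [DecidableEq G.ConnectedComponent]
    (C : G.ConnectedComponent) (v : C) :
    piToggleHom G (Pi.mulSingle C ⟨_, toggle_mem_toggleGroup _ v⟩) = toggle (indepSets G) v := by
  ext1 X
  refine restrictToComponent_ext fun D => ?_
  rw [restrictToComponent_piToggleHom]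
  by_cases hD : D = C
  · subst hD
    rw [Pi.mulSingle_eq_same, restrictToComponent_toggle]
  · have hv : v.1 ∉ D.supp := fun hv => hD (hv.symm.trans v.2)
    rw [Pi.mulSingle_eq_of_ne hD, restrictToComponent_toggle_of_notMem hv]
    rfl

variable [Finite G.ConnectedComponent]

theorem range_piToggleHom : (piToggleHom G).range = toggleGroup (indepSets G) := by
  classical
  let S (C : G.ConnectedComponent) : Set (toggleGroup (indepSets C.toSimpleGraph)) :=
    (↑) ⁻¹' Set.range (toggle (indepSets C.toSimpleGraph))
  have hS (C : G.ConnectedComponent) : closure (S C) = ⊤ := Subgroup.closure_closure_coe_preimage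
  have himage : piToggleHom G '' (⋃ C, Pi.mulSingle C '' S C) =
      Set.range (toggle (indepSets G)) := by
    ext g
    constructor
    · rintro ⟨_, h, rfl⟩
      obtain ⟨C, ⟨_, _⟩, ⟨v, rfl⟩, rfl⟩ := Set.mem_iUnion.1 h
      exact ⟨v, (piToggleHom_mulSingle_toggle C v).symm⟩
    · rintro ⟨v, rfl⟩
      exact ⟨_, Set.mem_iUnion.2 ⟨_, _, ⟨⟨v, rfl⟩, rfl⟩, rfl⟩,
        piToggleHom_mulSingle_toggle (G.connectedComponentMk v) ⟨v, rfl⟩⟩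
  calc
    (piToggleHom G).range = Subgroup.map (piToggleHom G) ⊤ := MonoidHom.range_eq_map _
    _ = Subgroup.map (piToggleHom G) (closure (⋃ C, Pi.mulSingle C '' S C)) :=
      congrArg _ (closure_iUnion_image_mulSingle hS).symm
    _ = closure (piToggleHom G '' ⋃ C, Pi.mulSingle C '' S C) := MonoidHom.map_closure _ _
    _ = toggleGroup (indepSets G) := congrArg Subgroup.closure himage

variable (G) in
/-- The toggle group of the independent sets of a graph is the product of those of its
components. -/
noncomputable def toggleGroupEquivPi :
    toggleGroup (indepSets G) ≃*
      ((C : G.ConnectedComponent) → toggleGroup (indepSets C.toSimpleGraph)) :=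
  (((piToggleHom G).ofInjective piToggleHom_injective).trans
    (MulEquiv.subgroupCongr range_piToggleHom)).symm

theorem toggleGroupEquivPi_apply_restrictToComponent (g : toggleGroup (indepSets G))
    (C : G.ConnectedComponent) (X : indepSets G) :
    (toggleGroupEquivPi G g C).1 (restrictToComponent C X) = restrictToComponent C (g.1 X) := by
  have hg : piToggleHom G (toggleGroupEquivPi G g) = g :=
    congrArg Subtype.val ((toggleGroupEquivPi G).symm_apply_apply g)
  rw [← restrictToComponent_piToggleHom, hg]

end Components

end ToggleGroup

theorem mainTheorem7 {V : Type*} [Finite V] (G : SimpleGraph V) :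
    (G.Connected → ToggleGroup.ToggleAlternating (ToggleGroup.indepSets G)) ∧
    (∃ φ : ToggleGroup.toggleGroup (ToggleGroup.indepSets G) ≃*
        ((C : G.ConnectedComponent) →
          ToggleGroup.toggleGroup (ToggleGroup.indepSets C.toSimpleGraph)),
      ∀ (g : ToggleGroup.toggleGroup (ToggleGroup.indepSets G)) (C : G.ConnectedComponent)
        (X : ToggleGroup.indepSets G),
        (φ g C).1 (ToggleGroup.restrictToComponent C X) =
          ToggleGroup.restrictToComponent C (g.1 X)) :=
  ⟨ToggleGroup.toggleAlternating_indepSets, ToggleGroup.toggleGroupEquivPi G,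
    ToggleGroup.toggleGroupEquivPi_apply_restrictToComponent⟩
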